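/- For $a\in\mathbb{C}$ and $k\in\mathbb{N}_0$ let $(a)_k=a(a+1)\cdots(a+k-1)$, and let $${}_pF_q\left(\begin{array}{c}a_1,\dots,a_p\\ b_1,\dots,b_q\end{array};z\right)=\sum_{k=0}^\infty\frac{(a_1)_k\cdots(a_p)_k}{(b_1)_k\cdots(b_q)_k}\,\frac{z^k}{k!},$$ where, if some $(b_j)_k$ vanishes, the coefficient is understood after cancellation of common zeros, i.e. as the limit for $t\to0$ of the quotient with all parameters $a_i,b_j$ replaced by $a_i+t,b_j+t$. (Thus $(b+m)_k/(b)_k$ means $(b+k)_m/(b)_m$ whenever $(b)_m\neq0$; in particular $(f+1)_k/(f)_k=(f+k)/f$ for every $f\ne0$.) Let $r\geq 0$, let $m_1,\dots,m_r$ be positive integers, $n=m_1+\cdots+m_r$, and let $e_1,\dots,e_r,\alpha,\gamma,\epsilon\in\mathbb{C}$. Assume that $\gamma\notin\{0,-1,-2,\dots\}$ and that $e_i\notin\{0,-1,\dots,-(m_i-1)\}$ for all $i$ (so, for $m_i=1$, just $e_i\neq0$), and that the parameters are non-degenerate in the sense that $\alpha-e_i\notin\{0,1,\dots,m_i-1\}$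 for all $i$ and $\gamma-\alpha\notin\{1,2,\dots,n\}$. Then there exist $f_1,\dots,f_n\in\mathbb{C}\setminus\{0\}$ such that for all $x\in\mathbb{C}$ the two hypergeometric series below converge absolutely and $${}_{r+1}F_{r+1}\left(\begin{array}{c}\alpha,\ e_1+m_1,\dots,e_r+m_r\\ \gamma,\ e_1,\dots,e_r\end{array};\,-\epsilon x\right)=e^{-\epsilon x}\,{}_{n+1}F_{n+1}\left(\begin{array}{c}\gamma-\alpha-n,\ f_1+1,\dots,f_n+1\\ \gamma,\ f_1,\dots,f_n\end{array};\,\epsilon x\right).$$ -/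

import Mathlib

open Filter Topology

/-- The `k`-th coefficient `(a₁)ₖ ⋯ (a_p)ₖ / ((b₁)ₖ ⋯ (b_q)ₖ)` of the generalized hypergeometric
series. If no `(b_j)ₖ` vanishes this is the plain quotient (`genHypCoeff_eq`). If some `(b_j)ₖ`
vanishes, a vanishing denominator factor is cancelled against a vanishing numerator factor, by
shifting all parameters by `t` and letting `t → 0`; so for instance
`(b + 1)ₖ / (b)ₖ` is `(b + k) / b` for all `b ≠ 0` (`genHypCoeff_cons`). -/
noncomputable def genHypCoeff {p q : ℕ} (a : Fin p → ℂ) (b : Fin q → ℂ) (k : ℕ) : ℂ :=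
  limUnder (𝓝[≠] (0 : ℂ)) fun t : ℂ =>
    (∏ i, (ascPochhammer ℂ k).eval (a i + t)) / ∏ j, (ascPochhammer ℂ k).eval (b j + t)

/-- The `k`-th term of the generalized hypergeometric series `p F q (a; b; z)`. -/
noncomputable def genHypTerm {p q : ℕ} (a : Fin p → ℂ) (b : Fin q → ℂ) (z : ℂ) (k : ℕ) : ℂ :=
  genHypCoeff a b k * z ^ k / (k.factorial : ℂ)

/-- The generalized hypergeometric function `p F q (a; b; z)`. -/
noncomputable def genHyp {p q : ℕ} (a : Fin p → ℂ) (b : Fin q → ℂ) (z : ℂ) : ℂ :=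
  ∑' k : ℕ, genHypTerm a b z k

theorem genHypCoeff_eq {p q : ℕ} (a : Fin p → ℂ) (b : Fin q → ℂ) (k : ℕ)
    (hb : ∀ j, (ascPochhammer ℂ k).eval (b j) ≠ 0) :
    genHypCoeff a b k =
      (∏ i, (ascPochhammer ℂ k).eval (a i)) / ∏ j, (ascPochhammer ℂ k).eval (b j) := by
  have hc : ContinuousAt (fun t : ℂ =>
      (∏ i, (ascPochhammer ℂ k).eval (a i + t)) / ∏ j, (ascPochhammer ℂ k).eval (b j + t)) 0 := by
    refine ContinuousAt.div (by fun_prop) (by fun_prop) ?_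
    simpa [Finset.prod_ne_zero_iff] using hb
  have h := (hc.tendsto.mono_left (nhdsWithin_le_nhds (s := {0}ᶜ))).limUnder_eq
  simpa [genHypCoeff] using h

/-- For parameters of the form `α, e₁ + m₁, …, e_r + m_r; γ, e₁, …, e_r` with natural numbers `m_i`
the coefficient is `(α)ₖ / (γ)ₖ · ∏ (e_i + k)_{m_i} / (e_i)_{m_i}`. -/
theorem genHypCoeff_cons {r : ℕ} (α γ : ℂ) (e : Fin r → ℂ) (m : Fin r → ℕ) (k : ℕ)
    (hγ : (ascPochhammer ℂ k).eval γ ≠ 0)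
    (he : ∀ i, (ascPochhammer ℂ (m i)).eval (e i) ≠ 0) :
    genHypCoeff (Fin.cons α fun i => e i + m i : Fin (r + 1) → ℂ)
        (Fin.cons γ e : Fin (r + 1) → ℂ) k =
      (ascPochhammer ℂ k).eval α / (ascPochhammer ℂ k).eval γ *
        ∏ i, (ascPochhammer ℂ (m i)).eval (e i + k) / (ascPochhammer ℂ (m i)).eval (e i) := by
  have hc : ContinuousAt (fun t : ℂ =>
      (ascPochhammer ℂ k).eval (α + t) / (ascPochhammer ℂ k).eval (γ + t) *
        ((∏ i, (ascPochhammer ℂ (m i)).eval (e i + k + t)) /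
          ∏ i, (ascPochhammer ℂ (m i)).eval (e i + t))) 0 := by
    refine ContinuousAt.mul (ContinuousAt.div (by fun_prop) (by fun_prop) (by simpa using hγ))
      (ContinuousAt.div (by fun_prop) (by fun_prop) ?_)
    simpa [Finset.prod_ne_zero_iff] using he
  have hev : ∀ i (l : ℕ), ∀ᶠ t in 𝓝[≠] (0 : ℂ), (ascPochhammer ℂ l).eval (e i + t) ≠ 0 := by
    intro i l
    have hp : ((ascPochhammer ℂ l).comp (Polynomial.C (e i) + Polynomial.X)) ≠ 0 := by
      have : ((ascPochhammer ℂ l).comp (Polynomial.C (e i) + Polynomial.X)).Monic := by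
        rw [add_comm]
        exact (monic_ascPochhammer ℂ l).comp_X_add_C _
      exact this.ne_zero
    have hf := Polynomial.finite_setOfPred_isRoot hp
    have h3 : ({x | Polynomial.IsRoot ((ascPochhammer ℂ l).comp
        (Polynomial.C (e i) + Polynomial.X)) x} \ {0})ᶜ ∈ 𝓝 (0 : ℂ) :=
      (hf.subset Set.sdiff_subset).isClosed.isOpen_compl.mem_nhds (by simp)
    filter_upwards [nhdsWithin_le_nhds h3, self_mem_nhdsWithin] with t ht ht0 h0
    exact ht ⟨by simpa [Polynomial.IsRoot] using h0, ht0⟩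
  have hev' : ∀ᶠ t in 𝓝[≠] (0 : ℂ), ∀ i, (ascPochhammer ℂ k).eval (e i + t) ≠ 0 ∧
      (ascPochhammer ℂ (m i)).eval (e i + t) ≠ 0 :=
    eventually_all.2 fun i => (hev i k).and (hev i (m i))
  have h := (hc.tendsto.mono_left (nhdsWithin_le_nhds (s := {0}ᶜ)))
  have h' := (h.congr' (f₂ := fun t : ℂ =>
    (∏ i, (ascPochhammer ℂ k).eval ((Fin.cons α fun i => e i + m i : Fin (r + 1) → ℂ) i + t)) /
      ∏ j, (ascPochhammer ℂ k).eval ((Fin.cons γ e : Fin (r + 1) → ℂ) j + t)) (by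
    filter_upwards [hev'] with t ht
    simp only [Fin.prod_univ_succ, Fin.cons_zero, Fin.cons_succ]
    rw [mul_div_mul_comm, ← Finset.prod_div_distrib, ← Finset.prod_div_distrib]
    congr 1
    refine Finset.prod_congr rfl fun i _ => ?_
    rw [div_eq_div_iff (ht i).2 (ht i).1]
    have e1 := congrArg (Polynomial.eval (e i + t)) (ascPochhammer_mul ℂ k (m i))
    have e2 := congrArg (Polynomial.eval (e i + t)) (ascPochhammer_mul ℂ (m i) k)
    rw [add_comm (m i) k, ← e1] at e2
    simp only [Polynomial.eval_mul, Polynomial.eval_comp, Polynomial.eval_add, Polynomial.eval_X,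
      Polynomial.eval_natCast] at e2
    rw [add_right_comm (e i) (k : ℂ) t, add_right_comm (e i) (m i : ℂ) t]
    linear_combination -e2)).limUnder_eq
  rw [genHypCoeff, h']
  simp [Finset.prod_div_distrib]

open Polynomial

/-!
Cancelling the parameter pairs turns both sides into series `∑ (a)ₖ / (c)ₖ P(k) zᵏ / k!` with a
polynomial `P`. Newton's forward difference formula, combined with the Cauchy product, gives
`∑ uₖ wᵏ / k! = exp w * ∑ (Δᵏ u)(0) wᵏ / k!` for every sequence `u`, so the task is to compute the
differences of `uₖ = (α)ₖ / (γ)ₖ P(k)`. Since `Δ` maps `(a)ₖ / (c)ₖ` to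
`-((c - a) / c) (a)ₖ / (c + 1)ₖ`, the `N`-th difference of `(a)ₖ / (c)ₖ` at `0` is
`(-1)ᴺ (c - a)_N / (c)_N`. Expanding `P = ∑ dⱼ (X + α)ⱼ` and using
`(α)ₖ (α + k)ⱼ = (α)ⱼ (α + j)ₖ`, one finds `(Δᴺ u)(0) = (-1)ᴺ (γ - α - n)_N / (γ)_N Q(N)` for a
polynomial `Q` with `Q(0) = P(0)` whose coefficient at `Xⁿ` is `P(-α) / (γ - α - n)ₙ`. The
non-degeneracy assumptions make this coefficient finite and nonzero, so `Q` has exactly `n` roots,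
and these are the `-fⱼ`.
-/

section Pochhammer

variable {R : Type*} [CommRing R]

theorem ascPochhammer_eval_add (a : R) (k l : ℕ) :
    (ascPochhammer R (k + l)).eval a =
      (ascPochhammer R k).eval a * (ascPochhammer R l).eval (a + k) := by
  simp [← ascPochhammer_mul, eval_comp]

theorem ascPochhammer_eval_succ_left (a : R) (k : ℕ) :
    (ascPochhammer R (k + 1)).eval a = a * (ascPochhammer R k).eval (a + 1) := by
  simp [ascPochhammer_succ_left, eval_comp]

theorem ascPochhammer_eval_mul_eval_add_comm (a : R) (k l : ℕ) :
    (ascPochhammer R k).eval a * (ascPochhammer R l).eval (a + k) =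
      (ascPochhammer R l).eval a * (ascPochhammer R k).eval (a + l) := by
  rw [← ascPochhammer_eval_add, add_comm, ascPochhammer_eval_add]

theorem ascPochhammer_eval_ne_zero_of_le {a : R} {k n : ℕ} (hkn : k ≤ n)
    (hn : (ascPochhammer R n).eval a ≠ 0) : (ascPochhammer R k).eval a ≠ 0 := by
  rw [← Nat.add_sub_cancel' hkn, ascPochhammer_eval_add] at hn
  exact left_ne_zero_of_mul hn

theorem ascPochhammer_eval_ne_zero [IsDomain R] {a : R} {n : ℕ} (h : ∀ s < n, a ≠ -(s : R)) :
    (ascPochhammer R n).eval a ≠ 0 := by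
  rw [Ne, ascPochhammer_eval_eq_zero_iff]
  rintro ⟨s, hs, hsa⟩
  exact h s hs (by rw [hsa, neg_neg])

/-- The rising factorial `(X + a)ₖ` as a polynomial in `X`. -/
noncomputable def shiftedPochhammer (a : R) (k : ℕ) : R[X] :=
  (ascPochhammer R k).comp (X + C a)

@[simp]
theorem shiftedPochhammer_zero (a : R) : shiftedPochhammer a 0 = 1 := by
  simp [shiftedPochhammer]

@[simp]
theorem shiftedPochhammer_one (a : R) : shiftedPochhammer a 1 = X + C a := by
  simp [shiftedPochhammer]

@[simp]
theorem eval_shiftedPochhammer (a x : R) (k : ℕ) :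
    (shiftedPochhammer a k).eval x = (ascPochhammer R k).eval (a + x) := by
  simp [shiftedPochhammer, eval_comp, add_comm]

theorem shiftedPochhammer_succ (a : R) (k : ℕ) :
    shiftedPochhammer a (k + 1) = (X + C a) * shiftedPochhammer (a + 1) k := by
  simp [shiftedPochhammer, ascPochhammer_succ_left, comp_assoc, add_assoc]

theorem monic_shiftedPochhammer [IsDomain R] (a : R) (k : ℕ) : (shiftedPochhammer a k).Monic :=
  (monic_ascPochhammer R k).comp_X_add_C a

@[simp]
theorem natDegree_shiftedPochhammer [IsDomain R] (a : R) (k : ℕ) :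
    (shiftedPochhammer a k).natDegree = k := by
  simp [shiftedPochhammer, natDegree_comp]

theorem exists_eq_sum_shiftedPochhammer {n : ℕ} {P : R[X]} (hP : P.natDegree ≤ n)
    (a : R) : ∃ d : ℕ → R, d 0 = P.eval (-a) ∧
      P = ∑ j ∈ Finset.range (n + 1), C (d j) * shiftedPochhammer a j := by
  induction n generalizing P a with
  | zero =>
    obtain ⟨p, rfl⟩ := natDegree_eq_zero.1 (Nat.le_zero.1 hP)
    exact ⟨fun _ => p, by simp, by simp⟩
  | succ n ih =>
    have hdeg : (P /ₘ (X - C (-a))).natDegree ≤ n := by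
      nontriviality R
      rw [natDegree_divByMonic _ (monic_X_sub_C _), natDegree_X_sub_C]
      lia
    obtain ⟨d, -, hd⟩ := ih hdeg (a + 1)
    refine ⟨fun | 0 => P.eval (-a) | j + 1 => d j, rfl, ?_⟩
    have hdiv : P = C (P.eval (-a)) + (X + C a) * (P /ₘ (X - C (-a))) := by
      rw [← modByMonic_X_sub_C_eq_C_eval, ← sub_neg_eq_add X, ← C_neg, modByMonic_add_div]
    rw [Finset.sum_range_succ', add_comm]
    simpa only [hd, Finset.mul_sum, shiftedPochhammer_succ, mul_left_comm, shiftedPochhammer_zero,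
      mul_one] using hdiv

end Pochhammer

section PochhammerRatio

variable {K : Type*} [Field K]

/-- The coefficient `(a)ₖ / (c)ₖ` of `zᵏ / k!` in Kummer's function `₁F₁(a; c; z)`. -/
noncomputable def pochhammerRatio (a c : K) (k : ℕ) : K :=
  (ascPochhammer K k).eval a / (ascPochhammer K k).eval c

@[simp]
theorem pochhammerRatio_zero (a c : K) : pochhammerRatio a c 0 = 1 := by
  simp [pochhammerRatio]

theorem pochhammerRatio_succ (a c : K) (k : ℕ) :
    pochhammerRatio a c (k + 1) = pochhammerRatio a c k * ((a + k) / (c + k)) := by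
  simp only [pochhammerRatio, ascPochhammer_succ_eval, mul_div_mul_comm]

theorem pochhammerRatio_mul_ascPochhammer (a c : K) (k j : ℕ) :
    pochhammerRatio a c k * (ascPochhammer K j).eval (a + k) =
      (ascPochhammer K j).eval a * pochhammerRatio (a + j) c k := by
  rw [pochhammerRatio, pochhammerRatio, div_mul_eq_mul_div,
    ascPochhammer_eval_mul_eval_add_comm, mul_div_assoc]

theorem pochhammerRatio_mul_eval_sum_shiftedPochhammer (a c : K) (d : ℕ → K) (s : Finset ℕ)
    (k : ℕ) :
    pochhammerRatio a c k * (∑ j ∈ s, C (d j) * shiftedPochhammer a j).eval (k : K) =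
      ∑ j ∈ s, d j * (ascPochhammer K j).eval a * pochhammerRatio (a + j) c k := by
  simp only [eval_finsetSum, eval_mul, eval_C, eval_shiftedPochhammer, Finset.mul_sum, mul_assoc,
    ← pochhammerRatio_mul_ascPochhammer, mul_left_comm (pochhammerRatio a c k)]

variable {c : K}

theorem add_natCast_ne_zero_of_ascPochhammer_eval_ne_zero
    (hc : ∀ k, (ascPochhammer K k).eval c ≠ 0) (k : ℕ) : c + k ≠ 0 :=
  right_ne_zero_of_mul (ascPochhammer_succ_eval k c ▸ hc (k + 1))

theorem fwdDiff_pochhammerRatio (a : K) (hc : ∀ k, (ascPochhammer K k).eval c ≠ 0) :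
    fwdDiff 1 (pochhammerRatio a c) = (-((c - a) / c)) • pochhammerRatio a (c + 1) := by
  ext k
  have hc₀ : c ≠ 0 := by simpa using hc 1
  have hck : c + k ≠ 0 := add_natCast_ne_zero_of_ascPochhammer_eval_ne_zero hc k
  have hshift : (ascPochhammer K k).eval (c + 1) = (ascPochhammer K k).eval c * (c + k) / c := by
    rw [eq_div_iff hc₀, mul_comm, ← ascPochhammer_eval_succ_left, ascPochhammer_succ_eval]
  have := hc k
  simp only [fwdDiff, pochhammerRatio_succ, Pi.smul_apply, smul_eq_mul]
  simp only [pochhammerRatio, hshift]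
  field_simp
  ring

theorem fwdDiff_iter_pochhammerRatio (a : K) (hc : ∀ k, (ascPochhammer K k).eval c ≠ 0) (N : ℕ) :
    (fwdDiff 1)^[N] (pochhammerRatio a c) =
      ((-1) ^ N * pochhammerRatio (c - a) c N) • pochhammerRatio a (c + N) := by
  induction N with
  | zero => simp
  | succ N ih =>
    have hcN : ∀ k, (ascPochhammer K k).eval (c + N) ≠ 0 := fun k =>
      right_ne_zero_of_mul (ascPochhammer_eval_add c N k ▸ hc (N + k))
    rw [Function.iterate_succ_apply', ih, fwdDiff_const_smul, fwdDiff_pochhammerRatio a hcN,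
      smul_smul, pochhammerRatio_succ]
    push_cast
    rw [add_assoc, pow_succ, sub_add_eq_add_sub]
    congr 1
    ring

theorem fwdDiff_iter_pochhammerRatio_zero (a : K) (hc : ∀ k, (ascPochhammer K k).eval c ≠ 0)
    (N : ℕ) :
    (fwdDiff 1)^[N] (pochhammerRatio a c) 0 = (-1) ^ N * pochhammerRatio (c - a) c N := by
  simp [fwdDiff_iter_pochhammerRatio a hc]

end PochhammerRatio

section AssociatedPolynomial

variable {K : Type*} [Field K] {n : ℕ}

/-- If `P = ∑ j ≤ n, dⱼ (X + a)ⱼ`, this is the polynomial that takes the place of `P` when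
Kummer's transformation is applied to `∑ (a)ₖ / (c)ₖ P(k) zᵏ / k!`, with `b = c - a - n`. -/
noncomputable def associatedPolynomial (n : ℕ) (a b : K) (d : ℕ → K) : K[X] :=
  ∑ j ∈ Finset.range (n + 1),
    C (d j * (ascPochhammer K j).eval a / (ascPochhammer K (n - j)).eval b) *
      shiftedPochhammer b (n - j)

theorem natDegree_associatedPolynomial_le (a b : K) (d : ℕ → K) :
    (associatedPolynomial n a b d).natDegree ≤ n :=
  natDegree_sum_le_of_forall_le _ _ fun j _ => (natDegree_C_mul_le _ _).trans (by simp)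

theorem coeff_associatedPolynomial (a b : K) (d : ℕ → K) :
    (associatedPolynomial n a b d).coeff n = d 0 / (ascPochhammer K n).eval b := by
  have hlead : (shiftedPochhammer b n).coeff n = 1 := by
    simpa using (monic_shiftedPochhammer b n).coeff_natDegree
  have hlower : ∀ j ∈ Finset.range n, (shiftedPochhammer b (n - (j + 1))).coeff n = 0 :=
    fun j hj => coeff_eq_zero_of_natDegree_lt (by
      rw [natDegree_shiftedPochhammer]
      exact Nat.sub_lt_of_pos_le j.succ_pos (Finset.mem_range.1 hj))
  rw [associatedPolynomial, finsetSum_coeff, Finset.sum_range_succ',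
    Finset.sum_eq_zero fun j hj => by rw [coeff_C_mul, hlower j hj, mul_zero]]
  simp [hlead]

theorem pochhammerRatio_mul_eval_associatedPolynomial (a c : K) {b : K} (d : ℕ → K)
    (hb : (ascPochhammer K n).eval b ≠ 0) (N : ℕ) :
    pochhammerRatio b c N * (associatedPolynomial n a b d).eval (N : K) =
      ∑ j ∈ Finset.range (n + 1),
        d j * (ascPochhammer K j).eval a * pochhammerRatio (b + (n - j : ℕ)) c N := by
  simp only [associatedPolynomial, eval_finsetSum, Finset.mul_sum]
  refine Finset.sum_congr rfl fun j _ => ?_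
  have hbj := ascPochhammer_eval_ne_zero_of_le (Nat.sub_le n j) hb
  rw [eval_mul, eval_C, eval_shiftedPochhammer, mul_left_comm, pochhammerRatio_mul_ascPochhammer,
    ← mul_assoc, div_mul_cancel₀ _ hbj]

theorem exists_fwdDiff_iter_pochhammerRatio_mul_eval {a c : K} {P : K[X]} (hP : P.natDegree ≤ n)
    (hc : ∀ k, (ascPochhammer K k).eval c ≠ 0)
    (hb : (ascPochhammer K n).eval (c - a - n) ≠ 0) (ha : P.eval (-a) ≠ 0) :
    ∃ Q : K[X], Q.natDegree = n ∧ Q.eval 0 = P.eval 0 ∧ ∀ N : ℕ,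
      (fwdDiff 1)^[N] (fun k : ℕ => pochhammerRatio a c k * P.eval (k : K)) 0 =
        (-1) ^ N * (pochhammerRatio (c - a - n) c N * Q.eval (N : K)) := by
  obtain ⟨d, hd₀, hd⟩ := exists_eq_sum_shiftedPochhammer hP a
  have hcoeff : (associatedPolynomial n a (c - a - n) d).coeff n ≠ 0 := by
    rw [coeff_associatedPolynomial, hd₀]
    exact div_ne_zero ha hb
  have hPsum : (fun k : ℕ => pochhammerRatio a c k * P.eval (k : K)) =
      ∑ j ∈ Finset.range (n + 1),
        (d j * (ascPochhammer K j).eval a) • pochhammerRatio (a + j) c := by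
    ext k
    rw [hd, pochhammerRatio_mul_eval_sum_shiftedPochhammer]
    simp
  have hQsum := pochhammerRatio_mul_eval_associatedPolynomial a c d hb
  refine ⟨associatedPolynomial n a (c - a - n) d,
    natDegree_eq_of_le_of_coeff_ne_zero (natDegree_associatedPolynomial_le _ _ _) hcoeff, ?_,
    fun N => ?_⟩
  · simpa using (hQsum 0).trans (by simpa using (congrFun hPsum 0).symm)
  · rw [hPsum, hQsum, fwdDiff_iter_finsetSum, Finset.sum_apply, Finset.mul_sum]
    refine Finset.sum_congr rfl fun j hj => ?_
    have hjn : j ≤ n := Finset.mem_range_succ_iff.1 hj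
    have hparam : c - a - n + (n - j : ℕ) = c - (a + j) := by
      push_cast [hjn]
      ring
    rw [fwdDiff_iter_const_smul, Pi.smul_apply, fwdDiff_iter_pochhammerRatio_zero _ hc, hparam,
      smul_eq_mul, mul_left_comm]

end AssociatedPolynomial

theorem hasSum_mul_pow_div_factorial_of_fwdDiff_iter {𝕂 : Type*} [NormedField 𝕂]
    [NormedAlgebra ℚ 𝕂] [CompleteSpace 𝕂] (u : ℕ → 𝕂) (z : 𝕂)
    (hu : Summable fun k : ℕ => ‖(fwdDiff 1)^[k] u 0 * z ^ k / k.factorial‖) :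
    HasSum (fun k : ℕ => u k * z ^ k / k.factorial)
      (NormedSpace.exp z * ∑' k : ℕ, (fwdDiff 1)^[k] u 0 * z ^ k / k.factorial) := by
  have : CharZero 𝕂 := algebraRat.charZero 𝕂
  have hexp := NormedSpace.norm_expSeries_div_summable z
  have hcauchy : (fun N : ℕ => u N * z ^ N / N.factorial) = fun N : ℕ =>
      ∑ k ∈ Finset.range (N + 1), (fwdDiff 1)^[k] u 0 * z ^ k / k.factorial *
        (z ^ (N - k) / (N - k).factorial) := by
    ext N
    have hnewton := shift_eq_sum_fwdDiff_iter 1 u N 0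
    rw [nsmul_one, Nat.cast_id, zero_add] at hnewton
    rw [hnewton, Finset.sum_mul, Finset.sum_div]
    refine Finset.sum_congr rfl fun k hk => ?_
    have hkN : k ≤ N := Finset.mem_range_succ_iff.1 hk
    rw [nsmul_eq_mul, Nat.cast_choose 𝕂 hkN, ← pow_mul_pow_sub z hkN]
    have := Nat.cast_ne_zero (R := 𝕂).2 N.factorial_ne_zero
    field_simp
  rw [← (NormedSpace.expSeries_div_hasSum_exp z).tsum_eq, mul_comm,
    tsum_mul_tsum_eq_tsum_sum_range_of_summable_norm hu hexp, hcauchy]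
  exact (summable_norm_sum_mul_range_of_summable_norm hu hexp).of_norm.hasSum

section WeightedKummer

/-- The `k`-th term of `∑ (a)ₖ / (c)ₖ P(k) zᵏ / k!`, the series of Kummer's function
`₁F₁(a; c; z)` with coefficients weighted by the values of a polynomial `P`. -/
noncomputable def weightedKummerTerm {K : Type*} [Field K] (a c : K) (P : K[X]) (z : K)
    (k : ℕ) : K :=
  pochhammerRatio a c k * P.eval (k : K) * z ^ k / k.factorial

variable {𝕜 : Type*} [RCLike 𝕜] {a c : 𝕜}

theorem exists_norm_pochhammerRatio_le_pow (a : 𝕜) (hc : ∀ k, (ascPochhammer 𝕜 k).eval c ≠ 0) :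
    ∃ B : ℝ, ∀ k, ‖pochhammerRatio a c k‖ ≤ B ^ k := by
  have hck := add_natCast_ne_zero_of_ascPochhammer_eval_ne_zero hc
  have hinv : Tendsto (fun k : ℕ => (c + k)⁻¹) atTop (𝓝 0) :=
    tendsto_inv₀_cobounded.comp
      ((tendsto_const_add_cobounded c).comp tendsto_natCast_atTop_cobounded)
  have hratio : Tendsto (fun k : ℕ => (a + k) / (c + k)) atTop (𝓝 1) := by
    have hlim : Tendsto (fun k : ℕ => 1 + (a - c) * (c + k)⁻¹) atTop (𝓝 1) := by
      simpa using (hinv.const_mul (a - c)).const_add 1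
    refine hlim.congr fun k => ?_
    have := hck k
    field_simp
    ring
  obtain ⟨B, hB⟩ := hratio.norm.bddAbove_range
  refine ⟨B, fun k => ?_⟩
  induction k with
  | zero => simp
  | succ k ih =>
    rw [pochhammerRatio_succ, norm_mul, pow_succ]
    exact mul_le_mul ih (hB ⟨k, rfl⟩) (norm_nonneg _) ((norm_nonneg _).trans ih)

theorem summable_pochhammerRatio_mul_pow_div_factorial (a : 𝕜)
    (hc : ∀ k, (ascPochhammer 𝕜 k).eval c ≠ 0) (z : 𝕜) :
    Summable fun k : ℕ => pochhammerRatio a c k * z ^ k / k.factorial := by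
  obtain ⟨B, hB⟩ := exists_norm_pochhammerRatio_le_pow a hc
  refine Summable.of_norm_bounded (Real.summable_pow_div_factorial (B * ‖z‖)) fun k => ?_
  rw [norm_div, norm_mul, norm_pow, RCLike.norm_natCast, mul_pow]
  gcongr
  exact hB k

theorem summable_weightedKummerTerm (a : 𝕜) (hc : ∀ k, (ascPochhammer 𝕜 k).eval c ≠ 0)
    (P : 𝕜[X]) (z : 𝕜) : Summable (weightedKummerTerm a c P z) := by
  obtain ⟨d, -, hd⟩ := exists_eq_sum_shiftedPochhammer P.natDegree.le_refl a
  have hsum : Summable fun k : ℕ => ∑ j ∈ Finset.range (P.natDegree + 1),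
      d j * (ascPochhammer 𝕜 j).eval a * (pochhammerRatio (a + j) c k * z ^ k / k.factorial) :=
    summable_sum fun j _ =>
      (summable_pochhammerRatio_mul_pow_div_factorial (a + j) hc z).mul_left _
  refine hsum.congr fun k => ?_
  rw [weightedKummerTerm, congrArg (eval _) hd, pochhammerRatio_mul_eval_sum_shiftedPochhammer,
    Finset.sum_mul, Finset.sum_div]
  simp only [mul_assoc, mul_div_assoc]

theorem exists_hasSum_weightedKummerTerm_neg {n : ℕ} {P : 𝕜[X]} (hP : P.natDegree ≤ n)
    (hc : ∀ k, (ascPochhammer 𝕜 k).eval c ≠ 0)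
    (hb : (ascPochhammer 𝕜 n).eval (c - a - n) ≠ 0) (ha : P.eval (-a) ≠ 0) :
    ∃ Q : 𝕜[X], Q.natDegree = n ∧ Q.eval 0 = P.eval 0 ∧ ∀ z,
      HasSum (weightedKummerTerm a c P (-z))
        (NormedSpace.exp (-z) * ∑' k, weightedKummerTerm (c - a - n) c Q z k) := by
  obtain ⟨Q, hQdeg, hQ₀, hdiff⟩ := exists_fwdDiff_iter_pochhammerRatio_mul_eval hP hc hb ha
  refine ⟨Q, hQdeg, hQ₀, fun z => ?_⟩
  have hterm : weightedKummerTerm (c - a - n) c Q z = fun k : ℕ =>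
      (fwdDiff 1)^[k] (fun k : ℕ => pochhammerRatio a c k * P.eval (k : 𝕜)) 0 *
        (-z) ^ k / k.factorial := by
    ext k
    rw [hdiff, weightedKummerTerm, mul_right_comm ((-1) ^ k), mul_right_comm, ← mul_pow,
      neg_one_mul, neg_neg, mul_comm (z ^ k), mul_right_comm]
  have hsum := (summable_weightedKummerTerm (c - a - n) hc Q z).norm
  rw [hterm] at hsum ⊢
  exact hasSum_mul_pow_div_factorial_of_fwdDiff_iter _ (-z) hsum

end WeightedKummer

section ParameterPolynomial

variable {R ι : Type*} [CommRing R] [Fintype ι]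

/-- The polynomial `∏ᵢ (X + eᵢ)_{mᵢ}`, whose values at `k` are, up to the factor `∏ᵢ (eᵢ)_{mᵢ}`,
the quotients `∏ᵢ (eᵢ + mᵢ)ₖ / (eᵢ)ₖ` contributed by the parameter pairs `eᵢ + mᵢ; eᵢ` of a
hypergeometric series. -/
noncomputable def parameterPolynomial (e : ι → R) (m : ι → ℕ) : R[X] :=
  ∏ i, shiftedPochhammer (e i) (m i)

theorem eval_parameterPolynomial (e : ι → R) (m : ι → ℕ) (x : R) :
    (parameterPolynomial e m).eval x = ∏ i, (ascPochhammer R (m i)).eval (e i + x) := by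
  simp [parameterPolynomial, eval_prod]

theorem natDegree_parameterPolynomial [IsDomain R] (e : ι → R) (m : ι → ℕ) :
    (parameterPolynomial e m).natDegree = ∑ i, m i := by
  simp [parameterPolynomial, natDegree_prod_of_monic _ _ fun _ _ => monic_shiftedPochhammer _ _]

theorem exists_eq_C_mul_parameterPolynomial_of_splits {K : Type*} [Field K] {Q : K[X]}
    (hQ : Q.Splits) {n : ℕ} (hn : Q.natDegree = n) :
    ∃ f : Fin n → K, Q = C Q.leadingCoeff * parameterPolynomial f fun _ => 1 := by
  obtain ⟨l, hl⟩ : ∃ l : List K, (l : Multiset K) = Q.roots := Quot.exists_rep _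
  obtain rfl : l.length = n := by rw [← hn, hQ.natDegree_eq_card_roots, ← hl, Multiset.coe_card]
  refine ⟨fun j => -l[j], ?_⟩
  conv_lhs => rw [hQ.eq_prod_roots, ← hl]
  simp [parameterPolynomial, sub_eq_add_neg, ← Fin.prod_univ_fun_getElem]

theorem genHypTerm_cons_add_natCast {r : ℕ} (α : ℂ) {γ : ℂ} {e : Fin r → ℂ} {m : Fin r → ℕ}
    (hγ : ∀ k, (ascPochhammer ℂ k).eval γ ≠ 0) (he : (parameterPolynomial e m).eval 0 ≠ 0) (z : ℂ) :
    genHypTerm (Fin.cons α fun i => e i + m i : Fin (r + 1) → ℂ)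
        (Fin.cons γ e : Fin (r + 1) → ℂ) z =
      fun k => weightedKummerTerm α γ (parameterPolynomial e m) z k /
        (parameterPolynomial e m).eval 0 := by
  simp only [eval_parameterPolynomial, add_zero] at he
  ext k
  rw [genHypTerm, genHypCoeff_cons α γ e m k (hγ k) fun i => Finset.prod_ne_zero_iff.1 he i
    (Finset.mem_univ i), Finset.prod_div_distrib, weightedKummerTerm, pochhammerRatio]
  simp only [eval_parameterPolynomial, add_zero]
  ring

theorem exists_genHypTerm_cons_add_one_eq {n : ℕ} {Q : ℂ[X]} (hn : Q.natDegree = n)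
    (hQ : Q.eval 0 ≠ 0) (β : ℂ) {γ : ℂ} (hγ : ∀ k, (ascPochhammer ℂ k).eval γ ≠ 0) :
    ∃ f : Fin n → ℂ, (∀ j, f j ≠ 0) ∧ ∀ z,
      genHypTerm (Fin.cons β fun j => f j + 1 : Fin (n + 1) → ℂ)
          (Fin.cons γ f : Fin (n + 1) → ℂ) z =
        fun k => weightedKummerTerm β γ Q z k / Q.eval 0 := by
  obtain ⟨f, hf⟩ := exists_eq_C_mul_parameterPolynomial_of_splits (IsAlgClosed.splits Q) hn
  have heval (x : ℂ) :
      Q.eval x = Q.leadingCoeff * (parameterPolynomial f fun _ => 1).eval x := by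
    conv_lhs => rw [hf, eval_mul, eval_C]
  rw [heval] at hQ
  obtain ⟨hlead, hf₀⟩ := mul_ne_zero_iff.1 hQ
  refine ⟨f, fun j => ?_, fun z => ?_⟩
  · simp only [eval_parameterPolynomial] at hf₀
    simpa using Finset.prod_ne_zero_iff.1 hf₀ j (Finset.mem_univ j)
  · have hterm := genHypTerm_cons_add_natCast β hγ hf₀ z
    simp only [Nat.cast_one] at hterm
    ext k
    simp only [hterm, heval, weightedKummerTerm]
    field_simp

end ParameterPolynomial

theorem mainTheorem5 (r n : ℕ) (e : Fin r → ℂ) (m : Fin r → ℕ) (α γ ε : ℂ)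
    (hm : ∀ i, 0 < m i) (hn : n = ∑ i, m i)
    -- both sides are defined
    (hγ : ∀ s : ℕ, γ ≠ -(s : ℂ))
    (he : ∀ i, ∀ s : ℕ, s < m i → e i ≠ -(s : ℂ))
    -- the parameters are not degenerate
    (hαe : ∀ i, ∀ s : ℕ, s < m i → α ≠ e i + s)
    (hαγ : ∀ s : ℕ, 1 ≤ s → s ≤ n → γ ≠ α + s) :
    ∃ f : Fin n → ℂ, (∀ j, f j ≠ 0) ∧ ∀ x : ℂ,
      Summable (genHypTerm (Fin.cons α fun i => e i + m i : Fin (r + 1) → ℂ)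
        (Fin.cons γ e : Fin (r + 1) → ℂ) (-(ε * x))) ∧
      Summable (genHypTerm (Fin.cons (γ - α - n) fun j => f j + 1 : Fin (n + 1) → ℂ)
        (Fin.cons γ f : Fin (n + 1) → ℂ) (ε * x)) ∧
      genHyp (Fin.cons α fun i => e i + m i : Fin (r + 1) → ℂ)
          (Fin.cons γ e : Fin (r + 1) → ℂ) (-(ε * x)) =
        Complex.exp (-(ε * x)) *
          genHyp (Fin.cons (γ - α - n) fun j => f j + 1 : Fin (n + 1) → ℂ)
            (Fin.cons γ f : Fin (n + 1) → ℂ) (ε * x) := by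
  set P := parameterPolynomial e m
  have hγ₀ (k : ℕ) : (ascPochhammer ℂ k).eval γ ≠ 0 := ascPochhammer_eval_ne_zero fun s _ => hγ s
  have hP₀ : P.eval 0 ≠ 0 := by
    rw [eval_parameterPolynomial, Finset.prod_ne_zero_iff]
    exact fun i _ => ascPochhammer_eval_ne_zero (by simpa using he i)
  have hPα : P.eval (-α) ≠ 0 := by
    rw [eval_parameterPolynomial, Finset.prod_ne_zero_iff]
    exact fun i _ => ascPochhammer_eval_ne_zero fun s hs h =>
      hαe i s hs (by linear_combination -h)
  have hβ : (ascPochhammer ℂ n).eval (γ - α - n) ≠ 0 :=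
    ascPochhammer_eval_ne_zero fun s hs h => hαγ (n - s) (by lia) (by lia) (by
      push_cast [hs.le]
      linear_combination h)
  obtain ⟨Q, hQdeg, hQ₀, hPQ⟩ :=
    exists_hasSum_weightedKummerTerm_neg (natDegree_parameterPolynomial e m ▸ hn.ge) hγ₀ hβ hPα
  obtain ⟨f, hf, hfQ⟩ :=
    exists_genHypTerm_cons_add_one_eq hQdeg (hQ₀ ▸ hP₀) (γ - α - n) hγ₀
  refine ⟨f, hf, fun x => ?_⟩
  rw [genHyp, genHyp, genHypTerm_cons_add_natCast α hγ₀ hP₀, hfQ, tsum_div_const, tsum_div_const,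
    (hPQ (ε * x)).tsum_eq, hQ₀, Complex.exp_eq_exp_ℂ, mul_div_assoc]
  exact ⟨(hPQ _).summable.div_const _,
    (summable_weightedKummerTerm _ hγ₀ Q _).div_const _, rfl⟩
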